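/- Let $n\ge 2$ and let $\mathcal O_n$ be the Cuntz algebra, i.e. the universal unital C*-algebra generated by elements $S_1,\dots,S_n$ with $S_k^*S_k=\mathbf 1$ for all $k$ and $\sum_{k=1}^n S_kS_k^*=\mathbf 1$. For a bounded operator $T$ on a complex Hilbert space $\mathcal H$ and a non-zero finite rank orthogonal projection $P$ on $\mathcal H$ put $\varphi(T,P)=\|TP-PT\|_2/\|P\|_2$, where $\|\cdot\|_2$ is the Hilbert–Schmidt norm. The operator $T$ is called strongly non-Følner if $\mathcal H$ is infinite dimensional and there is $\varepsilon>0$ such that $\varphi(T,P)\ge\varepsilon$ for all non-zero finite rank orthogonal projections $P$ on $\mathcal H$. Then: 1. $\mathcal O_n$ is singly generated: there is $c\in\mathcal O_n$ such that $\mathcal O_n=C^*(c)$, the smallest norm-closed (not necessarily unital) $*$-subalgebra containing $c$. 2. Any single generator of $\mathcal O_n$ is strongly non-Følner: let $\pi$ be a unital $*$-representation of $\mathcal O_n$ on a non-zero separable complex Hilbert space $\mathcal H$. If $c\in\mathcal O_n$ satisfies $C^*(c,\mathbf 1)=\mathcal O_n$, then $\pi(c)$ is strongly non-Følner; and every bounded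 operator $T$ on $\mathcal H$ with $C^*(T,\mathbf 1)=\pi(\mathcal O_n)$ is strongly non-Følner. -/

import Mathlib

open scoped ENNReal

noncomputable section

section Cuntz

/-- The Cuntz relations in a unital star ring: each `S k` is an isometry, and the range
projections `S k * (S k)^*` add up to the unit. -/
structure IsCuntzFamily {A : Type*} [Ring A] [StarRing A] {n : ℕ} (S : Fin n → A) : Prop where
  isometry : ∀ k, star (S k) * S k = 1
  sum_range : ∑ k, S k * star (S k) = 1

/-- The Hilbert space `ℓ²(ℕ)`. -/
abbrev Ell2 : Type := lp (fun _ : ℕ => ℂ) 2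

instance instNontrivialEll2 : Nontrivial Ell2 :=
  ⟨⟨lp.single 2 0 1, 0, fun h => by
    have := congrArg (fun f : Ell2 => f 0) h
    simp at this⟩⟩

/-- All realizations of the Cuntz relations by operators on `ℓ²(ℕ)`. -/
abbrev CuntzFamilyOnEll2 (n : ℕ) : Type :=
  {S : Fin n → (Ell2 →L[ℂ] Ell2) // IsCuntzFamily S}

/-- The C⋆-algebra of bounded families of operators on `ℓ²(ℕ)` indexed by all realizations of
the Cuntz relations, with pointwise operations and the supremum norm. -/
abbrev CuntzProduct (n : ℕ) : Type :=
  lp (fun _ : CuntzFamilyOnEll2 n => Ell2 →L[ℂ] Ell2) ∞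

instance instCStarAlgebraCuntzProduct (n : ℕ) : CStarAlgebra (CuntzProduct n) where

theorem norm_le_one_of_star_mul_self_eq_one {A : Type*} [CStarAlgebra A] {s : A}
    (h : star s * s = 1) : ‖s‖ ≤ 1 := by
  rcases subsingleton_or_nontrivial A with hA | hA
  · rw [Subsingleton.elim s 0]; simp
  · have := CStarRing.norm_star_mul_self (x := s)
    rw [h, CStarRing.norm_one] at this
    nlinarith [norm_nonneg s]

/-- The `k`-th universal isometry: its component at the realization `S` is `S k`. -/
def cuntzTuple (n : ℕ) (k : Fin n) : CuntzProduct n :=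
  ⟨fun S => S.1 k, memℓp_infty ⟨1, by
    rintro _ ⟨S, rfl⟩
    exact norm_le_one_of_star_mul_self_eq_one (S.2.isometry k)⟩⟩

/-- The norm-closed star subalgebra generated by the universal isometries. -/
def cuntzSubalgebra (n : ℕ) : StarSubalgebra ℂ (CuntzProduct n) :=
  (StarAlgebra.adjoin ℂ (Set.range (cuntzTuple n))).topologicalClosure

/-- The Cuntz algebra `𝓞ₙ`: the universal unital C⋆-algebra generated by `n` isometries satisfying
the Cuntz relations. It is the closure of the `*`-polynomials in the generators for the universal
norm, the supremum of the operator norms over all realizations of the relations. A unital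
C⋆-algebra generated by such a family is separable, hence acts faithfully on a separable Hilbert
space, and so the realizations on `ℓ²(ℕ)` give the whole supremum. -/
abbrev CuntzAlgebra (n : ℕ) : Type := cuntzSubalgebra n

instance instCStarAlgebraCuntzAlgebra (n : ℕ) : CStarAlgebra (CuntzAlgebra n) :=
  StarSubalgebra.cstarAlgebra _ (h_closed := StarSubalgebra.isClosed_topologicalClosure _)

/-- The canonical generating isometries of the Cuntz algebra. -/
def cuntzGen (n : ℕ) (k : Fin n) : CuntzAlgebra n :=
  ⟨cuntzTuple n k,
    StarSubalgebra.le_topologicalClosure _ (StarAlgebra.subset_adjoin ℂ _ ⟨k, rfl⟩)⟩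

theorem cuntzGen_isCuntzFamily (n : ℕ) : IsCuntzFamily (cuntzGen n) where
  isometry k := by
    apply Subtype.ext; apply lp.ext; funext S
    exact S.2.isometry k
  sum_range := by
    apply Subtype.ext; apply lp.ext; funext S
    have h := S.2.sum_range
    simp only [AddSubmonoidClass.coe_finsetSum]
    exact (Finset.sum_apply S _ _).trans h

end Cuntz

section Folner

variable {H : Type*} [NormedAddCommGroup H] [InnerProductSpace ℂ H]

theorem enorm_sq_eq_tsum_enorm_inner_sq {ι : Type*} (b : HilbertBasis ι ℂ H) (x : H) :
    ‖x‖ₑ ^ 2 = ∑' i, ‖inner ℂ (b i) x‖ₑ ^ 2 := by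
  have h2 : HasSum (fun i => ‖inner ℂ (b i) x‖ ^ 2) (‖x‖ ^ 2) := by
    have := (b.hasSum_inner_mul_inner x x).mapL Complex.reCLM
    simp only [Complex.reCLM_apply] at this
    convert this using 1
    · funext i
      rw [← inner_conj_symm x (b i), ← Complex.normSq_eq_conj_mul_self, Complex.ofReal_re,
        Complex.normSq_eq_norm_sq]
    · rw [inner_self_eq_norm_sq_to_K]; norm_cast
  have h3 := ENNReal.ofReal_tsum_of_nonneg (fun i => by positivity) h2.summable
  rw [h2.tsum_eq] at h3
  simpa [ENNReal.ofReal_pow, ofReal_norm] using h3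

variable [CompleteSpace H]

/-- The Hilbert–Schmidt norm `(∑ᵢ ‖T eᵢ‖²)^(1/2) ∈ [0, ∞]`, computed in an orthonormal (Hilbert)
basis `(eᵢ)` of `H`; it does not depend on the basis, see `hsNorm_eq`. -/
def hsNorm (T : H →L[ℂ] H) : ℝ≥0∞ :=
  (∑' i : (exists_hilbertBasis ℂ H).choose, ‖T (i : H)‖ₑ ^ 2) ^ (1 / 2 : ℝ)

theorem tsum_enorm_sq_eq_adjoint {ι κ : Type*} (b : HilbertBasis ι ℂ H) (c : HilbertBasis κ ℂ H)
    (T : H →L[ℂ] H) : ∑' i, ‖T (b i)‖ₑ ^ 2 = ∑' j, ‖T.adjoint (c j)‖ₑ ^ 2 := by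
  simp_rw [enorm_sq_eq_tsum_enorm_inner_sq c (T _),
    enorm_sq_eq_tsum_enorm_inner_sq b (T.adjoint _)]
  rw [ENNReal.tsum_comm]
  congr! 5 with j i
  rw [ContinuousLinearMap.adjoint_inner_right, ← inner_conj_symm, RCLike.enorm_conj]

theorem hsNorm_eq {ι : Type*} (b : HilbertBasis ι ℂ H) (T : H →L[ℂ] H) :
    hsNorm T = (∑' i, ‖T (b i)‖ₑ ^ 2) ^ (1 / 2 : ℝ) := by
  obtain ⟨c, hc⟩ := (exists_hilbertBasis ℂ H).choose_spec
  have h : ∀ i : (exists_hilbertBasis ℂ H).choose, (i : H) = c i := fun i => by rw [hc]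
  rw [hsNorm, tsum_congr (fun i => by rw [h i]), tsum_enorm_sq_eq_adjoint c b,
    tsum_enorm_sq_eq_adjoint b b, ContinuousLinearMap.adjoint_adjoint]

/-- `P` is a non-zero orthogonal projection of finite rank. -/
def IsNonzeroFiniteRankProjection (P : H →L[ℂ] H) : Prop :=
  IsStarProjection P ∧ P ≠ 0 ∧ FiniteDimensional ℂ P.range

/-- `φ(T, P) = ‖TP - PT‖₂ / ‖P‖₂`. -/
def folnerQuotient (T P : H →L[ℂ] H) : ℝ≥0∞ :=
  hsNorm (T * P - P * T) / hsNorm P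

/-- An operator `T` on an infinite-dimensional Hilbert space is strongly non-Følner if
`φ(T, P)` is bounded below by a positive constant over all non-zero orthogonal projections `P` of
finite rank. -/
def IsStronglyNonFolner (T : H →L[ℂ] H) : Prop :=
  ¬ FiniteDimensional ℂ H ∧
    ∃ ε : ℝ, 0 < ε ∧ ∀ P : H →L[ℂ] H, IsNonzeroFiniteRankProjection P →
      ENNReal.ofReal ε ≤ folnerQuotient T P

end Folner

end

/-!
Single generation rests on the identification of `𝓞ₙ` with matrices over itself. The `n ^ 2`
isometries `V w = S i * S j` have orthogonal ranges adding up to the unit, so an element is the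
matrix of its coefficients `(V v)⋆ * x * V w`, and `n ^ 2 ≥ 2 * n` diagonal places suffice for the
self-adjoint elements `re S k` and `im S k`. Let `b` be self-adjoint with these on its diagonal and
with ones in the remaining places of one row and column, and let `d` be diagonal with distinct
positive scalars. Both lie in `C*(d + i b)`. Interpolation (`range_projection_mem`) puts the range
projections into `C*(d)` without the unit, and these cut all matrix units and the corners
`V w * re S k * (V w)⋆`, `V w * im S k * (V w)⋆` out of `b`
(`exists_nonUnital_elemental_eq_top`). As `𝓞ₙ` is generated by the `S k`, this is everything.

For the second part, fix a sequence of projections `P m`. The operators `A` with `φ(A, P m) → 0`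
form a norm-closed unital star subalgebra (`folnerSubalgebra`, `isClosed_folnerSubalgebra`). If `T`
belongs to it, so do all elements of `C*(T, 1)`, in particular the images of the `S k`. This is
impossible (`IsCuntzFamily.exists_hsNorm_commutator_ge`): asymptotically
`‖(S k)⋆ P‖₂ = ‖P S k‖₂ ≈ ‖S k P‖₂ = ‖P‖₂`, whereas `∑ k, ‖(S k)⋆ P‖₂ ^ 2 = ‖P‖₂ ^ 2` and `n ≥ 2`.
The same inequality for `P = 1` excludes finite-dimensional spaces.
-/

/-! ### Isometries with orthogonal ranges -/

theorem IsCuntzFamily.star_mul_eq_ite {A : Type*} [CStarAlgebra A] {n : ℕ} {S : Fin n → A}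
    (hS : IsCuntzFamily S) (i j : Fin n) : star (S i) * S j = if i = j then 1 else 0 := by
  split_ifs with hij
  · rw [hij, hS.isometry]
  let _ := CStarAlgebra.spectralOrder A
  have := CStarAlgebra.spectralOrderedRing A
  -- `∑ i, (S i⋆ * S j)⋆ * (S i⋆ * S j) = 1`, and the term `i = j` is already `1`.
  have h1 : ∑ k, star (star (S k) * S j) * (star (S k) * S j) = 1 := by
    calc ∑ k, star (star (S k) * S j) * (star (S k) * S j)
        = star (S j) * (∑ k, S k * star (S k)) * S j := by
          simp only [Finset.mul_sum, Finset.sum_mul, star_mul, star_star, mul_assoc]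
      _ = 1 := by rw [hS.sum_range, mul_one, hS.isometry]
  rw [← Finset.add_sum_erase _ _ (Finset.mem_univ j), hS.isometry, star_one, mul_one,
    add_eq_left, Finset.sum_eq_zero_iff_of_nonneg (fun k _ => star_mul_self_nonneg _)] at h1
  exact CStarRing.star_mul_self_eq_zero_iff _ |>.mp (h1 i (by simp [hij]))

theorem mul_mul_star_eq_sum {A ι : Type*} [Ring A] [StarRing A] [Fintype ι] {V : ι → A}
    (hsum : ∑ i, V i * star (V i) = 1) (x : A) :
    x = ∑ i, ∑ j, V i * (star (V i) * x * V j) * star (V j) := by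
  calc x = (∑ i, V i * star (V i)) * x * ∑ j, V j * star (V j) := by rw [hsum, one_mul, mul_one]
    _ = _ := by simp only [Finset.mul_sum, Finset.sum_mul, mul_assoc]; exact Finset.sum_comm

section MatrixCoefficients

variable {A ι : Type*} [CStarAlgebra A] [Fintype ι] [DecidableEq ι] {V : ι → A}

theorem star_mul_sum_mul (hV : ∀ i j, star (V i) * V j = if i = j then 1 else 0)
    (M : ι → ι → A) (i j : ι) :
    star (V i) * (∑ k, ∑ l, V k * M k l * star (V l)) * V j = M i j := by
  calc star (V i) * (∑ k, ∑ l, V k * M k l * star (V l)) * V j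
      = ∑ k, ∑ l, (star (V i) * V k) * M k l * (star (V l) * V j) := by
        simp only [Finset.mul_sum, Finset.sum_mul, mul_assoc]
    _ = M i j := by simp [hV]

/-- A non-unital subalgebra containing a combination of orthogonal projections with distinct
non-zero coefficients contains the projections, by interpolation with a polynomial that vanishes
at `0`. -/
theorem range_projection_mem (hV : ∀ i j, star (V i) * V j = if i = j then 1 else 0)
    (hsum : ∑ i, V i * star (V i) = 1) {z : ι → ℂ} (hz : Function.Injective z)
    (hz0 : ∀ i, z i ≠ 0) {B : NonUnitalStarSubalgebra ℂ A}
    (hB : ∑ k, z k • (V k * star (V k)) ∈ B) (i : ι) : V i * star (V i) ∈ B := by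
  set d := ∑ k, z k • (V k * star (V k)) with hd
  -- `V k` is an eigenvector of left multiplication by `d`, so `f(d)` acts on it by `f (z k)`.
  have hdV (k : ι) : d * V k = z k • V k := by
    rw [hd, Finset.sum_mul, Finset.sum_eq_single k]
    · simp [mul_assoc, hV]
    · intro l _ hlk
      simp [mul_assoc, hV, hlk]
    · simp
  have hpow (m : ℕ) (k : ι) : d ^ m * V k = z k ^ m • V k := by
    induction m with
    | zero => simp
    | succ m ih => rw [pow_succ, mul_assoc, hdV, mul_smul_comm, ih, smul_smul, pow_succ']
  have haeval (f : Polynomial ℂ) (k : ι) : Polynomial.aeval d f * V k = f.eval (z k) • V k := by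
    induction f using Polynomial.induction_on' with
    | add p q hp hq => simp [add_mul, add_smul, hp, hq]
    | monomial m w => simp [Polynomial.aeval_monomial, hpow, smul_smul, ← Algebra.smul_def]
  have hpowB (m : ℕ) : d * d ^ m ∈ B := by
    induction m with
    | zero => simpa using hB
    | succ m ih => rw [pow_succ, ← mul_assoc]; exact B.mul_mem ih hB
  have hmemB (f : Polynomial ℂ) : d * Polynomial.aeval d f ∈ B := by
    induction f using Polynomial.induction_on' with
    | add p q hp hq => rw [map_add, mul_add]; exact B.add_mem hp hq
    | monomial m w =>
      rw [Polynomial.aeval_monomial, ← Algebra.smul_def, mul_smul_comm]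
      exact SMulMemClass.smul_mem w (hpowB m)
  -- The interpolating polynomial vanishing at `0` is `X * f`, up to the scalar `(z i)⁻¹`.
  set f := Lagrange.basis Finset.univ z i with hf
  have hval : d * Polynomial.aeval d f = z i • (V i * star (V i)) := by
    calc d * Polynomial.aeval d f
        = ∑ k, d * (Polynomial.aeval d f * V k) * star (V k) := by
          simp only [mul_assoc, ← Finset.mul_sum, hsum, mul_one]
      _ = ∑ k, (f.eval (z k) * z k) • (V k * star (V k)) := by
          simp only [haeval, mul_smul_comm, hdV, smul_smul, smul_mul_assoc]
      _ = _ := by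
          rw [Finset.sum_eq_single i]
          · rw [hf, Lagrange.eval_basis_self hz.injOn (Finset.mem_univ i), one_mul]
          · intro k _ hk
            rw [hf, Lagrange.eval_basis_of_ne hk.symm (Finset.mem_univ k), zero_mul, zero_smul]
          · simp
  have := SMulMemClass.smul_mem (z i)⁻¹ (hmemB f)
  rwa [hval, smul_smul, inv_mul_cancel₀ (hz0 i), one_smul] at this

/-- The elements `x` for which the corner `v * x * v⋆` by an isometry `v` lies in `B` form a star
subalgebra, unital when `B` contains the range projection of `v`. -/
def cornerSubalgebra (B : NonUnitalStarSubalgebra ℂ A) (v : A) (hv : star v * v = 1)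
    (hvB : v * star v ∈ B) : StarSubalgebra ℂ A where
  carrier := {x | v * x * star v ∈ B}
  mul_mem' {x y} hx hy := by
    have := B.mul_mem hx hy
    rwa [show v * x * star v * (v * y * star v) = v * x * (star v * v) * y * star v by
      simp only [mul_assoc], hv, mul_one, mul_assoc v x y] at this
  add_mem' {x y} hx hy := by
    have := B.add_mem hx hy
    rwa [← add_mul, ← mul_add] at this
  algebraMap_mem' r := by
    have : v * algebraMap ℂ A r * star v = r • (v * star v) := by
      rw [Algebra.algebraMap_eq_smul_one, mul_smul_comm, mul_one, smul_mul_assoc]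
    exact Set.mem_ofPred.mpr (this ▸ SMulMemClass.smul_mem r hvB)
  star_mem' {x} hx := by
    have := B.star_mem' hx
    rwa [star_mul, star_mul, star_star, ← mul_assoc] at this

/-- A C⋆-algebra containing `ι`-many isometries with orthogonal ranges adding up to the unit, and
generated by self-adjoint elements indexed by `ι`, is singly generated, even as a non-unital
algebra. With `V` as the isometries and `a` as the generators, a generator is `c = d + i b`, where
`d` has the matrix `diag z` and `b` the matrix `M` relative to the ranges of the `V i`. The
projections `V i * (V i)⋆` lie in `C*(d)` and cut the entries of `M` out of `b`. -/
theorem exists_nonUnital_elemental_eq_top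
    (hV : ∀ i j, star (V i) * V j = if i = j then 1 else 0)
    (hsum : ∑ i, V i * star (V i) = 1) (o : ι) (a : ι → A) (ha : ∀ i, IsSelfAdjoint (a i))
    (hgen : ∀ D : StarSubalgebra ℂ A, IsClosed (D : Set A) → (∀ i, a i ∈ D) → D = ⊤) :
    ∃ c : A, NonUnitalStarAlgebra.elemental ℂ c = ⊤ := by
  obtain ⟨z, hz, hz0, hzr⟩ : ∃ z : ι → ℂ, Function.Injective z ∧ (∀ i, z i ≠ 0) ∧
      ∀ i, star (z i) = z i := by
    refine ⟨fun i => ((Fintype.equivFin ι i : ℕ) + 1 : ℂ), fun i j h => ?_,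
      fun i => Nat.cast_add_one_ne_zero _, fun i => by simp⟩
    simpa [Fin.ext_iff.symm] using h
  -- The diagonal of `M` carries the generators; row and column `o` produce the matrix units.
  set M : ι → ι → A := fun i j => if i = j then a i else if i = o ∨ j = o then 1 else 0 with hM
  have hMstar (i j : ι) : star (M i j) = M j i := by
    by_cases hij : i = j
    · subst hij
      simp [hM, (ha i).star_eq]
    · by_cases hio : i = o ∨ j = o <;> simp [hM, hij, Ne.symm hij, hio, or_comm]
  set d := ∑ k, z k • (V k * star (V k)) with hd
  set b := ∑ k, ∑ l, V k * M k l * star (V l) with hb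
  have hdstar : star d = d := by
    simp only [hd, star_sum, star_smul, star_mul, star_star, hzr]
  have hbstar : star b = b := by
    rw [hb, star_sum, Finset.sum_comm]
    simp only [star_sum, star_mul, star_star, hMstar, mul_assoc]
  refine ⟨d + Complex.I • b, ?_⟩
  set c := d + Complex.I • b with hc
  set B := NonUnitalStarAlgebra.elemental ℂ c with hBdef
  have hcB : c ∈ B := NonUnitalStarAlgebra.elemental.self_mem ℂ c
  have hcstar : star c = d - Complex.I • b := by
    simp [hc, hdstar, hbstar, sub_eq_add_neg]
  have hscB : star c ∈ B := star_mem hcB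
  have hdB : d ∈ B := by
    have : d = (2⁻¹ : ℂ) • (c + star c) := by
      rw [hcstar, hc]; module
    exact this ▸ SMulMemClass.smul_mem _ (add_mem hcB hscB)
  have hbB : b ∈ B := by
    have : b = (-Complex.I * 2⁻¹ : ℂ) • (c - star c) := by
      rw [hcstar, hc, add_sub_sub_cancel, ← two_smul ℂ (Complex.I • b), smul_smul, smul_smul,
        show -Complex.I * 2⁻¹ * 2 * Complex.I = 1 by ring_nf; simp, one_smul]
    exact this ▸ SMulMemClass.smul_mem _ (sub_mem hcB hscB)
  have hpB (i : ι) : V i * star (V i) ∈ B := range_projection_mem hV hsum hz hz0 hdB i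
  have hMB (i j : ι) : V i * M i j * star (V j) ∈ B := by
    have : V i * M i j * star (V j) = V i * star (V i) * b * (V j * star (V j)) := by
      rw [← star_mul_sum_mul hV M i j]
      simp only [mul_assoc, hb]
    exact this ▸ mul_mem (mul_mem (hpB i) hbB) (hpB j)
  have hrow (i : ι) : V o * star (V i) ∈ B := by
    by_cases h : o = i
    · exact h ▸ hpB o
    · simpa [hM, h] using hMB o i
  have hcol (i : ι) : V i * star (V o) ∈ B := by
    simpa using star_mem (hrow i)
  have hVV (i : ι) : star (V i) * V i = 1 := by simp [hV]
  set D := cornerSubalgebra B (V o) (hVV o) (hpB o) with hD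
  have hDmem (x : A) : x ∈ D ↔ V o * x * star (V o) ∈ B := Iff.rfl
  have hDtop : D = ⊤ := by
    refine hgen D ?_ fun i => ?_
    · exact (NonUnitalStarAlgebra.elemental.isClosed ℂ c).preimage
        (f := fun x => V o * x * star (V o)) (by fun_prop)
    · have h := mul_mem (mul_mem (hrow i) (hMB i i)) (hcol i)
      rw [hDmem]
      convert h using 1
      calc V o * a i * star (V o)
          = V o * (star (V i) * V i) * a i * (star (V i) * V i) * star (V o) := by
            rw [hVV, mul_one, mul_one]
        _ = _ := by simp only [hM, if_true, mul_assoc]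
  refine eq_top_iff.mpr fun x _ => ?_
  rw [mul_mul_star_eq_sum hsum x]
  refine sum_mem fun i _ => sum_mem fun j _ => ?_
  have hy : star (V i) * x * V j ∈ D := hDtop ▸ StarSubalgebra.mem_top
  have h := mul_mem (mul_mem (hcol i) ((hDmem _).mp hy)) (hrow j)
  convert h using 1
  calc V i * (star (V i) * x * V j) * star (V j)
      = V i * (star (V o) * V o) * (star (V i) * x * V j) * (star (V o) * V o) * star (V j) := by
        rw [hVV, mul_one, mul_one]
    _ = _ := by simp only [mul_assoc]

end MatrixCoefficients

/-! ### Single generation of the Cuntz algebra -/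

theorem CuntzAlgebra.eq_top_of_cuntzGen_mem {n : ℕ} {D : StarSubalgebra ℂ (CuntzAlgebra n)}
    (hD : IsClosed (D : Set (CuntzAlgebra n))) (hgen : ∀ k, cuntzGen n k ∈ D) : D = ⊤ := by
  have hle : cuntzSubalgebra n ≤ D.map (cuntzSubalgebra n).subtype := by
    refine StarSubalgebra.topologicalClosure_minimal (StarAlgebra.adjoin_le ?_) ?_
    · rintro _ ⟨k, rfl⟩
      exact ⟨cuntzGen n k, hgen k, rfl⟩
    · exact (StarSubalgebra.isClosed_topologicalClosure
        (StarAlgebra.adjoin ℂ (Set.range (cuntzTuple n)))).isClosedEmbedding_subtypeVal.isClosedMap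
        _ hD
  refine eq_top_iff.mpr fun x _ => ?_
  obtain ⟨y, hy, hyx⟩ := hle x.2
  exact Subtype.ext hyx ▸ hy

/-- The `n ^ 2` products `S i * S j` are isometries with orthogonal ranges adding up to the unit,
and `n ^ 2 ≥ 2 * n` leaves room for the real and imaginary parts of all generators. -/
theorem CuntzAlgebra.exists_nonUnital_elemental_eq_top {n : ℕ} (hn : 2 ≤ n) :
    ∃ c : CuntzAlgebra n, NonUnitalStarAlgebra.elemental ℂ c = ⊤ := by
  set S := cuntzGen n with hSdef
  have hS : IsCuntzFamily S := cuntzGen_isCuntzFamily n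
  let o : Fin n := ⟨0, by omega⟩
  let l : Fin n := ⟨1, by omega⟩
  refine _root_.exists_nonUnital_elemental_eq_top (V := fun w : Fin n × Fin n => S w.1 * S w.2)
    (fun v w => ?_) ?_ (o, o)
    (fun w => if w.2 = o then (realPart (S w.1) : CuntzAlgebra n) else imaginaryPart (S w.1))
    (fun w => ?_) fun D hD hmem => CuntzAlgebra.eq_top_of_cuntzGen_mem hD fun k => ?_
  · calc star (S v.1 * S v.2) * (S w.1 * S w.2)
        = star (S v.2) * (star (S v.1) * S w.1) * S w.2 := by simp only [star_mul, mul_assoc]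
      _ = _ := by
        rw [hS.star_mul_eq_ite]
        by_cases h : v.1 = w.1
        · simp [h, hS.star_mul_eq_ite, Prod.ext_iff]
        · simp [h, Prod.ext_iff]
  · rw [Fintype.sum_prod_type]
    calc ∑ i, ∑ j, S i * S j * star (S i * S j)
        = ∑ i, S i * (∑ j, S j * star (S j)) * star (S i) := by
          simp only [star_mul, Finset.mul_sum, Finset.sum_mul, mul_assoc]
      _ = 1 := by simp only [hS.sum_range, mul_one]
  · split_ifs
    exacts [(realPart (S w.1)).2, (imaginaryPart (S w.1)).2]
  · have hre := hmem (k, o)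
    have him := hmem (k, l)
    have hlo : l ≠ o := by simp [l, o]
    simp only [if_true, hlo, if_false] at hre him
    rw [← realPart_add_I_smul_imaginaryPart (cuntzGen n k)]
    exact add_mem hre (SMulMemClass.smul_mem _ him)

/-! ### The Hilbert–Schmidt norm -/

section HilbertSchmidt

open Filter Topology

variable {H : Type*} [NormedAddCommGroup H] [InnerProductSpace ℂ H] [CompleteSpace H]

theorem hsNorm_sq {ι : Type*} (b : HilbertBasis ι ℂ H) (T : H →L[ℂ] H) :
    hsNorm T ^ 2 = ∑' i, ‖T (b i)‖ₑ ^ 2 := by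
  rw [hsNorm_eq b, ← ENNReal.rpow_natCast, ← ENNReal.rpow_mul]
  norm_num

theorem hsNorm_add_le (T U : H →L[ℂ] H) : hsNorm (T + U) ≤ hsNorm T + hsNorm U := by
  obtain ⟨w, b, hb⟩ := exists_hilbertBasis ℂ H
  let _ : MeasurableSpace w := ⊤
  have h := ENNReal.lintegral_Lp_add_le (μ := MeasureTheory.Measure.count (α := w)) (p := 2)
    (f := fun i => ‖T (b i)‖ₑ) (g := fun i => ‖U (b i)‖ₑ)
    measurable_from_top.aemeasurable measurable_from_top.aemeasurable one_le_two
  simp only [MeasureTheory.lintegral_count, Pi.add_apply, ENNReal.rpow_two] at h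
  rw [hsNorm_eq b, hsNorm_eq b T, hsNorm_eq b U]
  refine le_trans ?_ h
  gcongr with i
  exact enorm_add_le _ _

theorem hsNorm_star (T : H →L[ℂ] H) : hsNorm (star T) = hsNorm T := by
  obtain ⟨w, b, hb⟩ := exists_hilbertBasis ℂ H
  rw [hsNorm_eq b, hsNorm_eq b T, tsum_enorm_sq_eq_adjoint b b T]
  rfl

theorem hsNorm_mul_le (A T : H →L[ℂ] H) : hsNorm (A * T) ≤ ‖A‖ₑ * hsNorm T := by
  obtain ⟨w, b, hb⟩ := exists_hilbertBasis ℂ H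
  rw [← ENNReal.pow_le_pow_left_iff two_ne_zero, mul_pow, hsNorm_sq b, hsNorm_sq b,
    ← ENNReal.tsum_mul_left]
  gcongr with i
  rw [← mul_pow]
  gcongr
  exact A.le_opENorm _

theorem ContinuousLinearMap.enorm_star (A : H →L[ℂ] H) : ‖star A‖ₑ = ‖A‖ₑ := by
  simp [enorm]

theorem hsNorm_mul_le' (T A : H →L[ℂ] H) : hsNorm (T * A) ≤ hsNorm T * ‖A‖ₑ := by
  have h := hsNorm_mul_le (star A) (star T)
  rwa [← star_mul, hsNorm_star, hsNorm_star, ContinuousLinearMap.enorm_star, mul_comm] at h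

theorem hsNorm_neg (T : H →L[ℂ] H) : hsNorm (-T) = hsNorm T := by
  simp [hsNorm]

theorem hsNorm_isometry_mul {S : H →L[ℂ] H} (hS : star S * S = 1) (T : H →L[ℂ] H) :
    hsNorm (S * T) = hsNorm T := by
  have hS1 : ‖S‖ₑ ≤ 1 := by
    rw [← ofReal_norm, ENNReal.ofReal_le_one]
    exact norm_le_one_of_star_mul_self_eq_one hS
  refine le_antisymm ?_ ?_
  · exact (hsNorm_mul_le S T).trans (mul_le_of_le_one_left' hS1)
  · have h := hsNorm_mul_le (star S) (S * T)
    rw [← mul_assoc, hS, one_mul, ContinuousLinearMap.enorm_star] at h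
    exact h.trans (mul_le_of_le_one_left' hS1)

theorem hsNorm_ne_zero {T : H →L[ℂ] H} (hT : T ≠ 0) : hsNorm T ≠ 0 := by
  obtain ⟨w, b, hb⟩ := exists_hilbertBasis ℂ H
  intro h
  apply hT
  have h2 := hsNorm_sq b T
  rw [h, zero_pow two_ne_zero, eq_comm, ENNReal.tsum_eq_zero] at h2
  refine ContinuousLinearMap.ext_on
    (Submodule.dense_iff_topologicalClosure_eq_top.mpr b.dense_span) ?_
  · rintro _ ⟨i, rfl⟩
    simpa using h2 i

/-- In an orthonormal basis `u` of the range of `P`, exchanging sums gives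
`hsNorm P ^ 2 = ∑ j, ‖u j‖ ^ 2`, the rank of `P`. -/
theorem hsNorm_ne_top_of_isStarProjection {P : H →L[ℂ] H} (hP : IsStarProjection P)
    (hfin : FiniteDimensional ℂ P.range) : hsNorm P ≠ ∞ := by
  obtain ⟨w, b, hb⟩ := exists_hilbertBasis ℂ H
  let u := stdOrthonormalBasis ℂ P.range
  have hPu (j) : P (u j : H) = u j := by
    obtain ⟨y, hy⟩ := (u j).2
    rw [← hy]
    exact congrArg (fun T : H →L[ℂ] H => T y) hP.isIdempotentElem.eq
  have hsym (x y : H) : inner ℂ x (P y) = inner ℂ (P x) y := by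
    rw [← ContinuousLinearMap.adjoint_inner_left]
    rw [show P.adjoint = P from hP.isSelfAdjoint.star_eq]
  have hexp (x : H) : ‖P x‖ₑ ^ 2 = ∑ j, ‖inner ℂ x (u j : H)‖ₑ ^ 2 := by
    have h := enorm_sq_eq_tsum_enorm_inner_sq u.toHilbertBasis (⟨P x, x, rfl⟩ : P.range)
    rw [tsum_fintype] at h
    refine Eq.trans h (Finset.sum_congr rfl fun j _ => ?_)
    rw [OrthonormalBasis.coe_toHilbertBasis, Submodule.coe_inner, hsym, hPu, ← inner_conj_symm,
      RCLike.enorm_conj]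
  have hsq : hsNorm P ^ 2 ≠ ∞ := by
    rw [hsNorm_sq b]
    simp_rw [hexp]
    rw [Summable.tsum_finsetSum (fun _ _ => ENNReal.summable)]
    simp_rw [← enorm_sq_eq_tsum_enorm_inner_sq b]
    simp
  exact fun h => hsq (by simp [h])

theorem IsNonzeroFiniteRankProjection.hsNorm_ne_zero {P : H →L[ℂ] H}
    (hP : IsNonzeroFiniteRankProjection P) : hsNorm P ≠ 0 :=
  _root_.hsNorm_ne_zero hP.2.1

theorem IsNonzeroFiniteRankProjection.hsNorm_ne_top {P : H →L[ℂ] H}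
    (hP : IsNonzeroFiniteRankProjection P) : hsNorm P ≠ ∞ :=
  hsNorm_ne_top_of_isStarProjection hP.1 hP.2.2

/-- The Cuntz relation `∑ S k * (S k)⋆ = 1` as a Pythagorean identity for the Hilbert–Schmidt
norm. -/
theorem sum_hsNorm_star_mul_sq {n : ℕ} {S : Fin n → H →L[ℂ] H} (hS : IsCuntzFamily S)
    (T : H →L[ℂ] H) : ∑ k, hsNorm (star (S k) * T) ^ 2 = hsNorm T ^ 2 := by
  obtain ⟨w, b, hb⟩ := exists_hilbertBasis ℂ H
  simp_rw [hsNorm_sq b]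
  rw [← Summable.tsum_finsetSum (fun _ _ => ENNReal.summable)]
  congr 1
  funext i
  set x := T (b i) with hx
  have h : ∑ k, ‖star (S k) x‖ ^ 2 = ‖x‖ ^ 2 := by
    have h1 := congrArg (fun U : H →L[ℂ] H => RCLike.re (inner ℂ x (U x))) hS.sum_range
    simp only [sum_apply, inner_sum, map_sum, one_apply_eq_self, inner_self_eq_norm_sq] at h1
    rw [← h1]
    refine Finset.sum_congr rfl fun k _ => ?_
    change _ = RCLike.re (inner ℂ x (S k (star (S k) x)))
    rw [← ContinuousLinearMap.adjoint_inner_left, ← ContinuousLinearMap.star_eq_adjoint,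
      inner_self_eq_norm_sq]
  have h2 := congrArg ENNReal.ofReal h
  rw [ENNReal.ofReal_sum_of_nonneg (fun _ _ => by positivity)] at h2
  simpa [ENNReal.ofReal_pow, ofReal_norm] using h2

/-- Left multiplication by the `S k` preserves `hsNorm P`, while the squares of `hsNorm (P * S k)`
only add up to `hsNorm P ^ 2`; hence some commutator `[S k, P]` is large. The constant `1 / 4`
works for every `n ≥ 2` because `2 * (1 - 1 / 4) ^ 2 > 1`. -/
theorem IsCuntzFamily.exists_hsNorm_commutator_ge {n : ℕ} (hn : 2 ≤ n) {S : Fin n → H →L[ℂ] H}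
    (hS : IsCuntzFamily S) {P : H →L[ℂ] H} (hP : IsNonzeroFiniteRankProjection P) :
    ∃ k, ENNReal.ofReal (1 / 4) ≤ folnerQuotient (S k) P := by
  by_contra! hlt
  have hP0 := hP.hsNorm_ne_zero
  have hPt := hP.hsNorm_ne_top
  have hpos : 0 < (hsNorm P).toReal := ENNReal.toReal_pos hP0 hPt
  set p := (hsNorm P).toReal with hp
  have hpP : hsNorm P = ENNReal.ofReal p := (ENNReal.ofReal_toReal hPt).symm
  have hlow (k : Fin n) : ENNReal.ofReal (3 / 4 * p) ≤ hsNorm (star (S k) * P) := by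
    have h1 : hsNorm (S k * P - P * S k) ≤ ENNReal.ofReal (1 / 4 * p) := by
      have h := (ENNReal.div_lt_iff (Or.inl hP0) (Or.inl hPt)).mp (hlt k)
      rw [hpP, ← ENNReal.ofReal_mul (by norm_num)] at h
      exact h.le
    have h2 := hsNorm_add_le (S k * P - P * S k) (P * S k)
    rw [sub_add_cancel, hsNorm_isometry_mul (hS.isometry k)] at h2
    have h3 : hsNorm (P * S k) = hsNorm (star (S k) * P) := by
      rw [← hsNorm_star (P * S k), star_mul, hP.1.isSelfAdjoint.star_eq]
    rw [h3, hpP] at h2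
    have h4 := h2.trans (add_le_add_left h1 _)
    rw [show (3 / 4 * p) = p - 1 / 4 * p by ring, ENNReal.ofReal_sub _ (by positivity)]
    exact tsub_le_iff_left.mpr h4
  have hsum := sum_hsNorm_star_mul_sq hS P
  have h5 : ∑ _k : Fin n, ENNReal.ofReal (3 / 4 * p) ^ 2 ≤ hsNorm P ^ 2 := by
    rw [← hsum]
    gcongr with k
    exact hlow k
  rw [Finset.sum_const, Finset.card_univ, Fintype.card_fin, hpP,
    ← ENNReal.ofReal_pow (by positivity), ← ENNReal.ofReal_pow hpos.le, ← ENNReal.ofReal_nsmul,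
    ENNReal.ofReal_le_ofReal_iff (by positivity), nsmul_eq_mul] at h5
  have hn' : (2 : ℝ) ≤ n := by exact_mod_cast hn
  nlinarith [mul_le_mul_of_nonneg_right hn' (sq_nonneg (3 / 4 * p)), sq_pos_of_pos hpos]

/-! ### Asymptotic commutants of projections -/

theorem folnerQuotient_add_le (A B P : H →L[ℂ] H) :
    folnerQuotient (A + B) P ≤ folnerQuotient A P + folnerQuotient B P := by
  rw [folnerQuotient, folnerQuotient, folnerQuotient, ← ENNReal.add_div]
  gcongr
  rw [show (A + B) * P - P * (A + B) = (A * P - P * A) + (B * P - P * B) by noncomm_ring]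
  exact hsNorm_add_le _ _

theorem folnerQuotient_mul_le (A B P : H →L[ℂ] H) :
    folnerQuotient (A * B) P ≤ ‖A‖ₑ * folnerQuotient B P + folnerQuotient A P * ‖B‖ₑ := by
  rw [folnerQuotient, folnerQuotient, folnerQuotient, ← mul_div_assoc,
    ← ENNReal.mul_div_right_comm, ← ENNReal.add_div]
  gcongr
  rw [show A * B * P - P * (A * B) = A * (B * P - P * B) + (A * P - P * A) * B by noncomm_ring]
  exact (hsNorm_add_le _ _).trans (add_le_add (hsNorm_mul_le _ _) (hsNorm_mul_le' _ _))

theorem folnerQuotient_star (A : H →L[ℂ] H) {P : H →L[ℂ] H} (hP : IsSelfAdjoint P) :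
    folnerQuotient (star A) P = folnerQuotient A P := by
  rw [folnerQuotient, folnerQuotient, ← hsNorm_star (A * P - P * A), ← hsNorm_neg, star_sub,
    star_mul, star_mul, hP.star_eq, neg_sub]

theorem folnerQuotient_le (A P : H →L[ℂ] H) : folnerQuotient A P ≤ 2 * ‖A‖ₑ := by
  refine ENNReal.div_le_of_le_mul ?_
  rw [sub_eq_add_neg]
  refine (hsNorm_add_le _ _).trans ?_
  rw [hsNorm_neg, two_mul, add_mul]
  exact add_le_add (hsNorm_mul_le _ _) ((hsNorm_mul_le' _ _).trans_eq (mul_comm _ _))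

/-- The operators `A` with `φ(A, P m) → 0`, for a sequence `P` of projections of finite rank; they
form a star subalgebra because `A ↦ A * P - P * A` is a derivation whose Hilbert–Schmidt norm is
the same at `A` and `star A`. -/
def folnerSubalgebra (P : ℕ → H →L[ℂ] H) (hP : ∀ m, IsNonzeroFiniteRankProjection (P m)) :
    StarSubalgebra ℂ (H →L[ℂ] H) where
  carrier := {A | Tendsto (fun m => folnerQuotient A (P m)) atTop (𝓝 0)}
  add_mem' {A B} hA hB := by
    have h := Tendsto.add hA hB
    rw [add_zero] at h
    exact tendsto_of_tendsto_of_tendsto_of_le_of_le tendsto_const_nhds h (fun _ => zero_le)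
      fun m => folnerQuotient_add_le A B (P m)
  mul_mem' {A B} hA hB := by
    have h := (ENNReal.Tendsto.const_mul hB (Or.inr (enorm_ne_top (x := A)))).add
      (ENNReal.Tendsto.mul_const hA (Or.inr (enorm_ne_top (x := B))))
    rw [mul_zero, zero_mul, add_zero] at h
    exact tendsto_of_tendsto_of_tendsto_of_le_of_le tendsto_const_nhds h (fun _ => zero_le)
      fun m => folnerQuotient_mul_le A B (P m)
  algebraMap_mem' r := by
    have h (m : ℕ) : folnerQuotient (algebraMap ℂ (H →L[ℂ] H) r) (P m) = 0 := by
      rw [folnerQuotient, Algebra.commutes, sub_self]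
      simp [hsNorm]
    exact (tendsto_congr h).mpr tendsto_const_nhds
  star_mem' {A} hA :=
    (tendsto_congr fun m => folnerQuotient_star A (hP m).1.isSelfAdjoint).mpr hA

/-- Closedness holds because the bound `φ(A, P) ≤ 2 ‖A‖` does not depend on `P`. -/
theorem isClosed_folnerSubalgebra (P : ℕ → H →L[ℂ] H)
    (hP : ∀ m, IsNonzeroFiniteRankProjection (P m)) :
    IsClosed (folnerSubalgebra P hP : Set (H →L[ℂ] H)) := by
  refine isClosed_of_closure_subset fun A hA => ?_
  refine ENNReal.tendsto_nhds_zero.mpr fun ε hε => ?_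
  obtain ⟨B, hB, hAB⟩ := EMetric.mem_closure_iff.mp hA (ε / 2 / 2)
    (ENNReal.half_pos (ENNReal.half_pos hε.ne').ne')
  filter_upwards [ENNReal.tendsto_nhds_zero.mp hB (ε / 2) (ENNReal.half_pos hε.ne')] with m hm
  calc folnerQuotient A (P m) = folnerQuotient ((A - B) + B) (P m) := by rw [sub_add_cancel]
    _ ≤ folnerQuotient (A - B) (P m) + folnerQuotient B (P m) := folnerQuotient_add_le _ _ _
    _ ≤ 2 * (ε / 2 / 2) + ε / 2 := by
        refine add_le_add ((folnerQuotient_le _ _).trans ?_) hm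
        rw [← edist_eq_enorm_sub]
        gcongr
    _ = ε := by
        rw [ENNReal.mul_div_cancel two_ne_zero ENNReal.ofNat_ne_top, ENNReal.add_halves]

theorem IsCuntzFamily.not_finiteDimensional [Nontrivial H] {n : ℕ} (hn : 2 ≤ n)
    {S : Fin n → H →L[ℂ] H} (hS : IsCuntzFamily S) : ¬ FiniteDimensional ℂ H := by
  intro hfin
  -- In finite dimension the identity is an admissible projection, and it commutes with each `S k`.
  have hP : IsNonzeroFiniteRankProjection (1 : H →L[ℂ] H) :=
    ⟨.one _, one_ne_zero, inferInstance⟩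
  obtain ⟨k, hk⟩ := hS.exists_hsNorm_commutator_ge hn hP
  rw [folnerQuotient, mul_one, one_mul, sub_self] at hk
  simp [hsNorm] at hk

/-- If `φ(T, ·)` were not bounded below, then along some sequence of projections all elements of
`C*(T, 1)`, the isometries `S k` among them, would commute asymptotically with the projections. -/
theorem IsCuntzFamily.isStronglyNonFolner [Nontrivial H] {n : ℕ} (hn : 2 ≤ n)
    {S : Fin n → H →L[ℂ] H} (hS : IsCuntzFamily S) {T : H →L[ℂ] H}
    (hT : ∀ k, S k ∈ StarAlgebra.elemental ℂ T) : IsStronglyNonFolner T := by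
  refine ⟨hS.not_finiteDimensional hn, ?_⟩
  by_contra! hcon
  choose P hP hlt using fun m : ℕ => hcon (1 / ((m : ℝ) + 1)) Nat.one_div_pos_of_nat
  have hTmem : T ∈ folnerSubalgebra P hP := by
    have h := ENNReal.tendsto_ofReal (tendsto_one_div_add_atTop_nhds_zero_nat (𝕜 := ℝ))
    rw [ENNReal.ofReal_zero] at h
    exact tendsto_of_tendsto_of_tendsto_of_le_of_le tendsto_const_nhds h (fun _ => zero_le)
      fun m => (hlt m).le
  have hSmem (k : Fin n) : S k ∈ folnerSubalgebra P hP :=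
    StarAlgebra.elemental.le_of_mem (isClosed_folnerSubalgebra P hP) hTmem (hT k)
  have hev : ∀ᶠ m in atTop, ∀ k, folnerQuotient (S k) (P m) < ENNReal.ofReal (1 / 4) :=
    eventually_all.mpr fun k =>
      Tendsto.eventually_lt_const (u := ENNReal.ofReal (1 / 4)) (by simp) (hSmem k)
  obtain ⟨m, hm⟩ := hev.exists
  obtain ⟨k, hk⟩ := hS.exists_hsNorm_commutator_ge hn (hP m)
  exact hk.not_gt (hm k)

end HilbertSchmidt

/-! ### Generators of the Cuntz algebra and of its representations -/

theorem IsCuntzFamily.map {A B : Type*} [Ring A] [StarRing A] [Algebra ℂ A] [Ring B] [StarRing B]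
    [Algebra ℂ B] {n : ℕ} {S : Fin n → A} (hS : IsCuntzFamily S) (π : A →⋆ₐ[ℂ] B) :
    IsCuntzFamily fun k => π (S k) where
  isometry k := by rw [← map_star, ← map_mul, hS.isometry, map_one]
  sum_range := by simp_rw [← map_star, ← map_mul, ← map_sum, hS.sum_range, map_one]

/-- The first conjunct uses the C⋆-algebra generated by `c` alone, without adjoining the unit; the
second asks only that `T` and the unit together generate the image of the Cuntz algebra. -/
theorem proposition6p1 (n : ℕ) (hn : 2 ≤ n) :
    (∃ c : CuntzAlgebra n, NonUnitalStarAlgebra.elemental ℂ c = ⊤) ∧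
    ∀ (H : Type*) [NormedAddCommGroup H] [InnerProductSpace ℂ H] [CompleteSpace H]
      [TopologicalSpace.SeparableSpace H] [Nontrivial H]
      (π : CuntzAlgebra n →⋆ₐ[ℂ] (H →L[ℂ] H)),
      (∀ c : CuntzAlgebra n, StarAlgebra.elemental ℂ c = ⊤ → IsStronglyNonFolner (π c)) ∧
      (∀ T : H →L[ℂ] H, StarAlgebra.elemental ℂ T = π.range → IsStronglyNonFolner T) := by
  refine ⟨CuntzAlgebra.exists_nonUnital_elemental_eq_top hn, ?_⟩
  intro H _ _ _ _ _ π
  have hS : IsCuntzFamily fun k => π (cuntzGen n k) := (cuntzGen_isCuntzFamily n).map π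
  have hcont : Continuous π := AddMonoidHomClass.continuous_of_bound π 1 fun a => by
    simpa only [one_mul] using NonUnitalStarAlgHom.norm_apply_le π a
  refine ⟨fun c hc => hS.isStronglyNonFolner hn fun k => ?_,
    fun T hT => hS.isStronglyNonFolner hn fun k => ?_⟩
  · have hle : StarAlgebra.elemental ℂ c ≤ (StarAlgebra.elemental ℂ (π c)).comap π :=
      StarAlgebra.elemental.le_of_mem
        ((StarAlgebra.elemental.isClosed ℂ (π c)).preimage hcont)
        (StarAlgebra.elemental.self_mem ℂ (π c))
    exact hle (hc ▸ StarSubalgebra.mem_top)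
  · rw [hT]
    exact ⟨_, rfl⟩
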